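/- Let $n,\nu\ge 0$ and $p\ge 2n$ be integers, let $\Sigma=(\sigma_{ij})$ be a Hermitian positive semidefinite (possibly singular) complex $p\times p$ matrix, and let $\mu_1,\dots,\mu_\nu\in\mathbb{C}^p$. Here $CN_p(\mu,\Sigma)$ denotes the complex normal distribution, i.e. the law of $X+\sqrt{-1}\,Y$ where $(X,Y)$ is a real $2p$-dimensional Gaussian vector with mean $(\operatorname{Re}\mu,\operatorname{Im}\mu)$ and covariance matrix $\begin{pmatrix}A&-B\\B&A\end{pmatrix}$, $\Sigma=2(A+\sqrt{-1}B)$ with $A,B$ real. Let $W=(w_{ij})_{1\le i,j\le p}$ be a random matrix with the complex noncentral Wishart distribution $CW_p(\nu,\Sigma,\Delta)$, that is, with the law of $\bigl(\sum_{t=1}^{\nu} z_{ti}\overline{z_{tj}}\bigr)_{ij}$ where $Z_t=(z_{ti})_i\sim CN_p(\mu_t,\Sigma)$, $t=1,\dots,\nu$, are independent, and where $\Delta=(\delta_{ij})$, $\delta_{ij}=\sum_{t=1}^{\nu}\mu_{ti}\overline{\mu_{tj}}$. Write $\overline{i}=n+i$ for $1\le i\le n$. Then $w_{1\overline1}w_{2\overline2}\cdots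 w_{n\overline n}$ is integrable and $$E[w_{1\overline1}w_{2\overline2}\cdots w_{n\overline n}]=\sum_{V_1,\pi}\nu^{\operatorname{len}(G)}\,\sigma^{E}\,\delta^{\check E},\qquad \sigma^E=\prod_{(i,i')\in E}\sigma_{i\overline{i'}},\qquad \delta^{\check E}=\prod_{(j,j')\in\check E}\delta_{j\overline{j'}}.$$ The sum is over all subsets $V_1\subset V=\{1,\dots,n\}$ and all injections $\pi:V_1\to V$. For given $(V_1,\pi)$, $G=(V,E)$ is the directed graph with edge set $E=\{(i,\pi(i)) : i\in V_1\}$. Each connected component of $G$ is either a directed cycle (no terminals; a loop is a cycle) or a directed chain (with one starting terminal, which no edge enters, and one ending terminal, which no edge leaves; for an isolated vertex the two coincide). $\operatorname{len}(G)$ is the number of cycles of $G$, $\check E$ is the set of pairs (ending terminal, starting terminal) of the chains of $G$, and $0^0=1$. -/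

import Mathlib

open MeasureTheory ProbabilityTheory
open scoped ComplexOrder

/-- Matrices carry the product `σ`-algebra of their entries. -/
noncomputable instance matrixMeasurableSpace {p : ℕ} : MeasurableSpace (Matrix (Fin p) (Fin p) ℂ) :=
  MeasurableSpace.pi (X := fun _ => Fin p → ℂ)

/-- The covariance matrix `[[A, -B], [B, A]]` of the real random vector `(X, Y)` whose
complexification `X + √-1 Y` has complex covariance matrix `S = 2 (A + √-1 B)`;
that is, `A = Re S / 2` and `B = Im S / 2`. -/
noncomputable def realCovariance {p : ℕ} (S : Matrix (Fin p) (Fin p) ℂ) :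
    Matrix (Fin p ⊕ Fin p) (Fin p ⊕ Fin p) ℝ :=
  Matrix.fromBlocks
    (S.map fun s => s.re / 2) (-(S.map fun s => s.im / 2))
    (S.map fun s => s.im / 2) (S.map fun s => s.re / 2)

/-- The real mean vector `(ξ, η)` attached to the complex mean vector `m = ξ + √-1 η`. -/
noncomputable def realMean {p : ℕ} (m : Fin p → ℂ) : EuclideanSpace ℝ (Fin p ⊕ Fin p) :=
  WithLp.toLp 2 (Sum.elim (fun i => (m i).re) (fun i => (m i).im))

/-- The complex normal distribution `CN_p(m, S)`: the law of `X + √-1 Y`, where `(X, Y)` is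
a real Gaussian vector with mean `(Re m, Im m)` and covariance `[[A, -B], [B, A]]`,
`S = 2 (A + √-1 B)`.  It is meant for positive semidefinite (possibly singular) `S`. -/
noncomputable def complexNormal {p : ℕ} (m : Fin p → ℂ) (S : Matrix (Fin p) (Fin p) ℂ) :
    Measure (Fin p → ℂ) :=
  (multivariateGaussian (realMean m) (realCovariance S)).map
    fun x i => (x (Sum.inl i) : ℂ) + Complex.I * (x (Sum.inr i) : ℂ)

/-- The `p × p` matrix with entries `∑ t, z t i * conj (z t j)`, built from `ν` vectors
`z 0, …, z (ν - 1)` of `ℂ^p`. -/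
noncomputable def gramSum {p ν : ℕ} (z : Fin ν → Fin p → ℂ) : Matrix (Fin p) (Fin p) ℂ :=
  Matrix.of fun i j => ∑ t, z t i * (starRingEnd ℂ) (z t j)

/-- `Q` is a complex noncentral Wishart distribution `CW_p(ν, S, D)`: it is the law of
`(∑ t, z_{ti} conj z_{tj})_{ij}`, where `z_1, …, z_ν` are independent with
`z_t ∼ CN_p(m_t, S)`, for mean vectors `m_t` with
`D = (∑ t, m_{ti} conj m_{tj})_{ij}`. -/
def IsComplexWishart {p : ℕ} (ν : ℕ) (S D : Matrix (Fin p) (Fin p) ℂ)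
    (Q : Measure (Matrix (Fin p) (Fin p) ℂ)) : Prop :=
  ∃ m : Fin ν → Fin p → ℂ, gramSum m = D ∧
    Q = (Measure.pi fun t => complexNormal (m t) S).map gramSum

/-- The directed graph on `{1, …, n}` (here `Fin n`) whose edges are the pairs `(i, π i)`,
`i ∈ V₁`, for an injection `π` from the subset `V₁` into `{1, …, n}`. -/
def injectionGraph {n : ℕ} (V₁ : Finset (Fin n)) (π : V₁ ↪ Fin n) : Digraph (Fin n) where
  Adj i j := ∃ h : i ∈ V₁, π ⟨i, h⟩ = j

/-- The (weakly) connected components of a directed graph, i.e. the connected components of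
the underlying undirected graph. -/
abbrev DiComponent {V : Type*} (G : Digraph V) : Type _ :=
  G.toSimpleGraphInclusive.ConnectedComponent

/-- The component of a vertex. -/
abbrev diComponentOf {V : Type*} (G : Digraph V) (v : V) : DiComponent G :=
  G.toSimpleGraphInclusive.connectedComponentMk v

/-- `v` is a starting terminal: no edge enters it. -/
def IsStartTerminal {V : Type*} (G : Digraph V) (v : V) : Prop := ∀ u, ¬ G.Adj u v

/-- `v` is an ending terminal: no edge leaves it. -/
def IsEndTerminal {V : Type*} (G : Digraph V) (v : V) : Prop := ∀ u, ¬ G.Adj v u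

/-- A component is a cycle if it has no terminals.  (For the graph of an injection, every
other component is a chain, with one starting and one ending terminal; these coincide for
an isolated vertex.) -/
def IsCycleComponent {V : Type*} (G : Digraph V) (c : DiComponent G) : Prop :=
  ∀ v, diComponentOf G v = c → ¬ IsStartTerminal G v ∧ ¬ IsEndTerminal G v

/-- `len(G)`: the number of components that are cycles. -/
noncomputable def numCycles {V : Type*} (G : Digraph V) : ℕ :=
  Nat.card {c : DiComponent G // IsCycleComponent G c}

open Classical in
/-- The set `E` of directed edges. -/
noncomputable def edgePairs {V : Type*} [Fintype V] (G : Digraph V) : Finset (V × V) :=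
  Finset.univ.filter fun e => G.Adj e.1 e.2

open Classical in
/-- The set `Ě` of pairs (ending terminal, starting terminal) of the chains. -/
noncomputable def chainPairs {V : Type*} [Fintype V] (G : Digraph V) : Finset (V × V) :=
  Finset.univ.filter fun e =>
    IsEndTerminal G e.1 ∧ IsStartTerminal G e.2 ∧ diComponentOf G e.1 = diComponentOf G e.2

/-- The index `i` as one of the indices `1, …, p`, where `2 n ≤ p`. -/
def plainIdx {n p : ℕ} (h : n + n ≤ p) (i : Fin n) : Fin p := Fin.castLE h (Fin.castAdd n i)

/-- The index `n + i` as one of the indices `1, …, p`, where `2 n ≤ p`. -/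
def barIdx {n p : ℕ} (h : n + n ≤ p) (i : Fin n) : Fin p := Fin.castLE h (Fin.natAdd n i)

/-!
The expectation is computed by Wick's formula, and the resulting sum over pairings is organised by
the graph of the pairing.

By `exists_complexNormal_eq_map`, each row `z_t` has the law of `m_t + L ξ_t`, with `ξ_t` a standard
real Gaussian vector, `L Lᵀ = 0` and `L Lᴴ = S`; singular `S` needs no separate treatment, since `L`
comes from a square root of the real covariance matrix. Hence `∏ i, w_{i,n+i}` is a polynomial in
independent standard real Gaussian variables. On polynomials, Gaussian integration by parts
(`gaussianExpectation_X_mul`) is the recursion for one-dimensional moments checked on monomials.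

Applied to a product of affine forms, integration by parts replaces a factor by its mean or contracts
it with another factor. As `E[(z - m)(z - m)ᵀ] = 0`, only contractions of an unconjugated with a
conjugated factor survive, so induction on the number of unconjugated factors gives a sum over partial
injections (`expectation_prod_mul_prod`). Expanding `w_{i,n+i} = ∑ t, z_{t,i} conj z_{t,n+i}` gives a
sum over row labels `f : {1, …, n} → {1, …, ν}` (`integral_prod_gramSum`). Rows with different labels
are independent, so a contraction along an edge `(i, π i)` contributes `S` if `f i = f (π i)` and `0`
otherwise.

For a fixed `π`, the surviving labellings are those constant on the components of its graph, and the
sum over them factors over components (`sum_prod_terminals`): a cycle carries no means and gives `ν`,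
while a chain from `j` to `i` gives `∑ t, m_{t,i} conj m_{t,n+j} = D_{i,n+j}`. That a
component which is not a cycle has exactly one terminal of each kind follows by counting its edges by
source and by target.
-/

/-! ### Stein's identity for polynomials in independent standard Gaussian variables -/

lemma integrable_pow_gaussianReal (n : ℕ) :
    Integrable (fun x : ℝ => x ^ n) (gaussianReal 0 1) := by
  have h := (memLp_id_gaussianReal (μ := 0) (v := 1) n).integrable_norm_pow'
  refine h.mono' (by fun_prop) (Filter.Eventually.of_forall fun x => ?_)
  simp

/-- For `n = 0` the truncated exponent `n - 1` is harmless because of the factor `n`. -/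
lemma integral_pow_succ_gaussianReal (n : ℕ) :
    ∫ x : ℝ, x ^ (n + 1) ∂gaussianReal 0 1 = n * ∫ x : ℝ, x ^ (n - 1) ∂gaussianReal 0 1 := by
  have hint (k : ℕ) : Integrable fun x : ℝ => gaussianPDFReal 0 1 x * x ^ k := by
    have h := integrable_pow_gaussianReal k
    rw [gaussianReal_of_var_ne_zero _ one_ne_zero,
      integrable_withDensity_iff_integrable_smul' (measurable_gaussianPDF _ _)
        (Filter.Eventually.of_forall fun _ => gaussianPDF_lt_top)] at h
    simpa [toReal_gaussianPDF] using h
  have hderiv (x : ℝ) : HasDerivAt (gaussianPDFReal 0 1) (-(gaussianPDFReal 0 1 x * x)) x := by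
    have h : HasDerivAt (fun y : ℝ => -(y - 0) ^ 2 / (2 * ((1 : NNReal) : ℝ))) (-x) x := by
      refine ((((hasDerivAt_id x).sub_const 0).pow 2).neg.div_const _).congr_deriv ?_
      simp
      ring
    refine (h.exp.const_mul (√(2 * Real.pi * ((1 : NNReal) : ℝ)))⁻¹).congr_deriv ?_
    simp only [gaussianPDFReal]
    ring
  have key := integral_mul_deriv_eq_deriv_mul_of_integrable (u := fun x : ℝ => x ^ n)
    (u' := fun x : ℝ => n * x ^ (n - 1)) (v := gaussianPDFReal 0 1)
    (v' := fun x => -(gaussianPDFReal 0 1 x * x)) (fun x _ => hasDerivAt_pow n x)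
    (fun x _ => hderiv x)
    ((hint (n + 1)).neg.congr (Filter.Eventually.of_forall fun x => by
      simp only [Pi.neg_apply, Pi.mul_apply]; ring))
    (((hint (n - 1)).const_mul n).congr (Filter.Eventually.of_forall fun x => by
      simp only [Pi.mul_apply]; ring))
    ((hint n).congr (Filter.Eventually.of_forall fun x => by
      simp only [Pi.mul_apply]; ring))
  simp only [integral_gaussianReal_eq_integral_smul one_ne_zero, smul_eq_mul]
  rw [← integral_const_mul]
  calc ∫ x : ℝ, gaussianPDFReal 0 1 x * x ^ (n + 1)
      = -∫ x : ℝ, x ^ n * -(gaussianPDFReal 0 1 x * x) := by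
        rw [← integral_neg]; congr 1; ext x; ring
    _ = _ := by
        rw [key, neg_neg]; congr 1; ext x; ring

section Stein

variable {τ κ : Type*} [Fintype τ] [Fintype κ]

/-- The law of a doubly indexed family of independent standard real Gaussian variables. -/
noncomputable def gaussianArray (τ κ : Type*) [Fintype τ] [Fintype κ] : Measure (τ → κ → ℝ) :=
  Measure.pi fun _ : τ => Measure.pi fun _ : κ => gaussianReal 0 1

open MvPolynomial in
lemma eval_monomial_array (s : τ × κ →₀ ℕ) (c : ℂ) (x : τ → κ → ℝ) :
    eval (fun k : τ × κ => (x k.1 k.2 : ℂ)) (monomial s c) =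
      c * ∏ t, ∏ i, (x t i : ℂ) ^ s (t, i) := by
  rw [eval_monomial, Finsupp.prod_fintype _ _ (by simp), Fintype.prod_prod_type]

lemma integrable_ofReal_pow_gaussianReal (n : ℕ) :
    Integrable (fun x : ℝ => (x : ℂ) ^ n) (gaussianReal 0 1) := by
  simpa using (integrable_pow_gaussianReal n).ofReal (𝕜 := ℂ)

open MvPolynomial in
lemma integrable_eval_gaussianArray (F : MvPolynomial (τ × κ) ℂ) :
    Integrable (fun x : τ → κ → ℝ => eval (fun k => (x k.1 k.2 : ℂ)) F) (gaussianArray τ κ) := by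
  induction F using MvPolynomial.induction_on' with
  | monomial s c =>
    simp only [eval_monomial_array]
    refine Integrable.const_mul (Integrable.fintype_prod (f := fun t (y : κ → ℝ) =>
      ∏ i, (y i : ℂ) ^ s (t, i)) fun t => ?_) c
    exact Integrable.fintype_prod (f := fun i (y : ℝ) => (y : ℂ) ^ s (t, i)) fun i =>
      integrable_ofReal_pow_gaussianReal _
  | add p q hp hq =>
    simp only [map_add]
    exact hp.add hq

open MvPolynomial in
/-- The expectation of a polynomial in the entries of a standard Gaussian array, as a linear
functional on polynomials. -/
noncomputable def gaussianExpectation (τ κ : Type*) [Fintype τ] [Fintype κ] :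
    MvPolynomial (τ × κ) ℂ →ₗ[ℂ] ℂ where
  toFun F := ∫ x, eval (fun k => (x k.1 k.2 : ℂ)) F ∂gaussianArray τ κ
  map_add' F G := by
    simp only [map_add]
    exact integral_add (integrable_eval_gaussianArray F) (integrable_eval_gaussianArray G)
  map_smul' c F := by
    simp only [smul_eval, RingHom.id_apply, smul_eq_mul]
    exact integral_const_mul _ _

open MvPolynomial in
lemma gaussianExpectation_monomial (s : τ × κ →₀ ℕ) (c : ℂ) :
    gaussianExpectation τ κ (monomial s c) =
      c * ∏ k, ((∫ x : ℝ, x ^ s k ∂gaussianReal 0 1 : ℝ) : ℂ) := by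
  change ∫ x, eval (fun k => (x k.1 k.2 : ℂ)) (monomial s c) ∂gaussianArray τ κ = _
  simp only [eval_monomial_array, gaussianArray]
  rw [integral_const_mul,
    integral_fintype_prod_eq_prod (f := fun t (y : κ → ℝ) => ∏ i, (y i : ℂ) ^ s (t, i)),
    Fintype.prod_prod_type]
  congr 1
  refine Finset.prod_congr rfl fun t _ => ?_
  rw [integral_fintype_prod_eq_prod (f := fun i (y : ℝ) => (y : ℂ) ^ s (t, i))]
  refine Finset.prod_congr rfl fun i _ => ?_
  rw [← integral_complex_ofReal]
  simp

lemma gaussianExpectation_one : gaussianExpectation τ κ 1 = 1 := by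
  have h := gaussianExpectation_monomial (τ := τ) (κ := κ) 0 1
  simpa using h

open MvPolynomial in
/-- **Stein's identity**, or Gaussian integration by parts. -/
lemma gaussianExpectation_X_mul (k : τ × κ) (F : MvPolynomial (τ × κ) ℂ) :
    gaussianExpectation τ κ (X k * F) = gaussianExpectation τ κ (pderiv k F) := by
  classical
  induction F using MvPolynomial.induction_on' with
  | monomial s c =>
    rw [X, monomial_mul, pderiv_monomial, gaussianExpectation_monomial,
      gaussianExpectation_monomial, ← Finset.mul_prod_erase _ _ (Finset.mem_univ k),
      ← Finset.mul_prod_erase _ _ (Finset.mem_univ k)]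
    have h : ∀ j ∈ Finset.univ.erase k, (Finsupp.single k 1 + s : τ × κ →₀ ℕ) j =
        (s - Finsupp.single k 1 : τ × κ →₀ ℕ) j := by
      intro j hj
      have hj : k ≠ j := (Finset.ne_of_mem_erase hj).symm
      simp [Finsupp.single_eq_of_ne' hj]
    rw [Finset.prod_congr rfl fun j hj => by rw [h j hj]]
    have h2 : (Finsupp.single k 1 + s : τ × κ →₀ ℕ) k = s k + 1 := by simp [add_comm]
    have h3 : (s - Finsupp.single k 1 : τ × κ →₀ ℕ) k = s k - 1 := by simp
    rw [h2, h3, integral_pow_succ_gaussianReal]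
    push_cast
    ring
  | add p q hp hq => rw [mul_add, map_add, map_add, map_add, hp, hq]

end Stein

/-! ### Wick's formula for circular families of affine forms -/

section Wick

open MvPolynomial

variable {σ : Type*} [Fintype σ]

/-- The polynomial `c + ∑ k, L k * X k` of degree at most one. -/
noncomputable def affineForm (c : ℂ) (L : σ → ℂ) : MvPolynomial σ ℂ := C c + ∑ k, C (L k) * X k

/-- The derivative in the direction `L`. -/
noncomputable def directionalDeriv (L : σ → ℂ) :
    Derivation ℂ (MvPolynomial σ ℂ) (MvPolynomial σ ℂ) := ∑ k, L k • pderiv k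

lemma directionalDeriv_apply (L : σ → ℂ) (F : MvPolynomial σ ℂ) :
    directionalDeriv L F = ∑ k, L k • pderiv k F := by
  rw [directionalDeriv, ← Derivation.coeFnAddMonoidHom_apply, map_sum, Finset.sum_apply]
  rfl

lemma directionalDeriv_affineForm (L L' : σ → ℂ) (c : ℂ) :
    directionalDeriv L (affineForm c L') = C (∑ k, L k * L' k) := by
  classical
  simp [directionalDeriv_apply, affineForm, pderiv_X, Pi.single_apply, smul_eq_C_mul]

lemma derivation_prod {R A ι : Type*} [CommRing R] [CommRing A] [Algebra R A] [DecidableEq ι]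
    (D : Derivation R A A) (s : Finset ι) (f : ι → A) :
    D (∏ i ∈ s, f i) = ∑ i ∈ s, (∏ j ∈ s.erase i, f j) * D (f i) := by
  induction s using Finset.induction_on with
  | empty => simp
  | insert a s ha ih =>
    rw [Finset.prod_insert ha, D.leibniz, ih, Finset.sum_insert ha, Finset.erase_insert ha,
      smul_eq_mul, smul_eq_mul, Finset.mul_sum, add_comm]
    congr 1
    refine Finset.sum_congr rfl fun i hi => ?_
    have hia : i ≠ a := fun h => ha (h ▸ hi)
    rw [Finset.erase_insert_of_ne hia.symm, Finset.prod_insert (by simp [ha])]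
    ring

variable (ℰ : MvPolynomial σ ℂ →ₗ[ℂ] ℂ)

/-- Integration by parts against one affine factor. The functional `ℰ` stands for an expectation; only
Stein's identity is used. -/
lemma expectation_affineForm_mul (hX : ∀ k F, ℰ (X k * F) = ℰ (pderiv k F))
    (c : ℂ) (L : σ → ℂ) (F : MvPolynomial σ ℂ) :
    ℰ (affineForm c L * F) = c * ℰ F + ℰ (directionalDeriv L F) := by
  simp [affineForm, directionalDeriv_apply, add_mul, Finset.sum_mul, C_mul', hX]

variable {β : Type*}

/-- A partial injection from `Fin k` to `B`, encoded by an `Option`-valued function: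
`none` marks the indices outside its domain. -/
def IsPartialInjection {k : ℕ} (B : Finset β) (g : Fin k → Option β) : Prop :=
  (∀ i b, g i = some b → b ∈ B) ∧ ∀ i j b, g i = some b → g j = some b → i = j

lemma isPartialInjection_cons_none {k : ℕ} (B : Finset β) (g : Fin k → Option β) :
    IsPartialInjection B (Fin.cons none g : Fin (k + 1) → Option β) ↔ IsPartialInjection B g := by
  simp [IsPartialInjection, Fin.forall_fin_succ]

lemma isPartialInjection_cons_some [DecidableEq β] {k : ℕ} (B : Finset β) (b : β)
    (g : Fin k → Option β) :
    IsPartialInjection B (Fin.cons (some b) g : Fin (k + 1) → Option β) ↔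
      b ∈ B ∧ IsPartialInjection (B.erase b) g := by
  simp only [IsPartialInjection, Fin.forall_fin_succ, Fin.cons_zero, Fin.cons_succ,
    Finset.mem_erase, Option.some.injEq, Fin.succ_inj]
  constructor
  · rintro ⟨⟨h1, h2⟩, ⟨-, h3⟩, h4⟩
    refine ⟨h1 b rfl, fun i b' hb' => ⟨?_, h2 i b' hb'⟩, fun i j => (h4 i).2 j⟩
    rintro rfl
    exact Fin.succ_ne_zero i (h3 i b' rfl hb').symm
  · rintro ⟨h1, h2, h3⟩
    refine ⟨⟨fun b' h => h ▸ h1, fun i b' h => (h2 i b' h).2⟩, ⟨by simp, ?_⟩, fun i => ⟨?_, h3 i⟩⟩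
    · rintro i b' rfl h
      exact absurd rfl (h2 i b h).1
    · rintro b' h rfl
      exact absurd rfl (h2 i b h).1

lemma sum_fin_succ_option [Fintype β] {k : ℕ} (F : (Fin (k + 1) → Option β) → ℂ) :
    ∑ g, F g = ∑ g : Fin k → Option β, F (Fin.cons none g) +
      ∑ b, ∑ g : Fin k → Option β, F (Fin.cons (some b) g) := by
  rw [← (Fin.consEquiv fun _ => Option β).sum_comp, Fintype.sum_prod_type, Fintype.sum_option]
  rfl

open Classical in
/-- **Wick's formula** for a noncentral circular family. The covariance of two affine forms is the
bilinear (not sesquilinear) product of their coefficient vectors. It vanishes between two forms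
`affineForm (c i) (L i)` and between two forms `affineForm (c' j) (L' j)`, and equals `K i j` between a
form of the first kind and one of the second. -/
theorem expectation_prod_mul_prod [Fintype β] (h1 : ℰ 1 = 1)
    (hX : ∀ k F, ℰ (X k * F) = ℰ (pderiv k F))
    (c' : β → ℂ) (L' : β → σ → ℂ) (hL' : ∀ j j', ∑ s, L' j s * L' j' s = 0)
    (k : ℕ) (c : Fin k → ℂ) (L : Fin k → σ → ℂ) (hL : ∀ i i', ∑ s, L i s * L i' s = 0)
    (K : Fin k → β → ℂ) (hK : ∀ i j, ∑ s, L i s * L' j s = K i j) (B : Finset β) :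
    ℰ ((∏ i, affineForm (c i) (L i)) * ∏ j ∈ B, affineForm (c' j) (L' j)) =
      ∑ g : Fin k → Option β, if IsPartialInjection B g then
        (∏ i, (g i).elim (c i) (K i)) * ∏ j ∈ B with ∀ i, g i ≠ some j, c' j else 0 := by
  induction k generalizing B with
  | zero =>
    have hB : ℰ (∏ j ∈ B, affineForm (c' j) (L' j)) = ∏ j ∈ B, c' j := by
      induction B using Finset.induction_on with
      | empty => simpa using h1
      | insert b B hb ih =>
        rw [Finset.prod_insert hb, Finset.prod_insert hb, expectation_affineForm_mul ℰ hX, ih,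
          derivation_prod]
        simp [directionalDeriv_affineForm, hL']
    simp [hB, IsPartialInjection]
  | succ k ih =>
    have hD : directionalDeriv (L 0) (∏ i : Fin k, affineForm (c i.succ) (L i.succ)) = 0 := by
      rw [derivation_prod]
      simp [directionalDeriv_affineForm, hL]
    -- The factor with index `0` yields its mean, or is contracted with a factor in `B`.
    rw [Fin.prod_univ_succ, mul_assoc, expectation_affineForm_mul ℰ hX, Derivation.leibniz, hD,
      smul_zero, add_zero, smul_eq_mul, derivation_prod, Finset.mul_sum, map_sum]
    simp only [directionalDeriv_affineForm, hK]
    have hC : ∀ b, ℰ ((∏ i : Fin k, affineForm (c i.succ) (L i.succ)) *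
        ((∏ j ∈ B.erase b, affineForm (c' j) (L' j)) * C (K 0 b))) =
        K 0 b * ℰ ((∏ i : Fin k, affineForm (c i.succ) (L i.succ)) *
          (∏ j ∈ B.erase b, affineForm (c' j) (L' j))) := by
      intro b
      rw [← mul_assoc, mul_comm _ (C _), C_mul', map_smul, smul_eq_mul]
    simp only [hC, ih (fun i => c i.succ) (fun i => L i.succ) (fun i i' => hL _ _)
      (fun i => K i.succ) (fun i j => hK _ _)]
    rw [sum_fin_succ_option]
    congr 1
    · rw [Finset.mul_sum]
      refine Finset.sum_congr rfl fun g _ => ?_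
      rw [if_congr (isPartialInjection_cons_none B g) rfl rfl]
      simp [Fin.prod_univ_succ, Fin.forall_fin_succ, mul_assoc]
    · rw [← Finset.sum_subset (Finset.subset_univ B) fun b _ hb => Finset.sum_eq_zero fun g _ =>
        if_neg fun h => hb ((isPartialInjection_cons_some B b g).1 h).1]
      refine Finset.sum_congr rfl fun b hb => ?_
      rw [Finset.mul_sum]
      refine Finset.sum_congr rfl fun g _ => ?_
      have hs : (B.filter fun j => ∀ i, (Fin.cons (some b) g : Fin (k + 1) → Option β) i ≠ some j) =
          (B.erase b).filter fun j => ∀ i, g i ≠ some j := by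
        ext j
        simp only [Finset.mem_filter, Finset.mem_erase, Fin.forall_fin_succ, Fin.cons_zero,
          Fin.cons_succ, ne_eq, Option.some.injEq]
        tauto
      rw [hs, if_congr ((isPartialInjection_cons_some B b g).trans (and_iff_right hb)) rfl rfl]
      simp [Fin.prod_univ_succ, mul_assoc]

end Wick

/-! ### The complex Wishart law as the image of a standard Gaussian array -/

lemma posSemidef_realCovariance {p : ℕ} {S : Matrix (Fin p) (Fin p) ℂ} (hS : S.PosSemidef) :
    (realCovariance S).PosSemidef := by
  have hre (i j) : (S j i).re = (S i j).re := by
    rw [← hS.isHermitian.apply i j]; simp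
  have him (i j) : (S j i).im = -(S i j).im := by
    rw [← hS.isHermitian.apply i j]; simp
  refine Matrix.PosSemidef.of_dotProduct_mulVec_nonneg ?_ fun x => ?_
  · ext i j
    rcases i with i | i <;> rcases j with j | j <;>
      simp [realCovariance, hre j i, him j i, neg_div]
  · -- The real quadratic form at `(u, v)` is half the Hermitian form of `S` at `u + √-1 v`.
    have h := hS.dotProduct_mulVec_nonneg
      fun i => (x (Sum.inl i) : ℂ) + Complex.I * (x (Sum.inr i) : ℂ)
    have h := (Complex.le_def.1 h).1
    have key : star x ⬝ᵥ (realCovariance S).mulVec x = (star (fun i : Fin p =>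
        (x (Sum.inl i) : ℂ) + Complex.I * (x (Sum.inr i) : ℂ)) ⬝ᵥ S.mulVec fun i =>
        (x (Sum.inl i) : ℂ) + Complex.I * (x (Sum.inr i) : ℂ)).re / 2 := by
      simp only [dotProduct, Matrix.mulVec, Fintype.sum_sum_type, Finset.mul_sum, Complex.re_sum,
        Finset.sum_div, realCovariance, Matrix.fromBlocks_apply₁₁, Matrix.fromBlocks_apply₁₂,
        Matrix.fromBlocks_apply₂₁, Matrix.fromBlocks_apply₂₂, ← Finset.sum_add_distrib]
      refine Finset.sum_congr rfl fun i _ => Finset.sum_congr rfl fun j _ => ?_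
      simp
      ring
    rw [key]
    exact div_nonneg h (by norm_num)

open scoped MatrixOrder in
/-- The complex normal law with covariance `S` is the law of `m + L ξ`, for `ξ` a standard real
Gaussian vector and a complex matrix `L` with `L Lᵀ = 0` and `L Lᴴ = S`. -/
lemma exists_complexNormal_eq_map {p : ℕ} {S : Matrix (Fin p) (Fin p) ℂ} (hS : S.PosSemidef) :
    ∃ L : Fin p → Fin p ⊕ Fin p → ℂ, (∀ i j, ∑ k, L i k * L j k = 0) ∧
      (∀ i j, ∑ k, L i k * (starRingEnd ℂ) (L j k) = S i j) ∧
      ∀ m : Fin p → ℂ, complexNormal m S =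
        (Measure.pi fun _ : Fin p ⊕ Fin p => gaussianReal 0 1).map
          fun ξ i => m i + ∑ k, L i k * (ξ k : ℂ) := by
  have hC := posSemidef_realCovariance hS
  set R : Matrix (Fin p ⊕ Fin p) (Fin p ⊕ Fin p) ℝ := CFC.sqrt (realCovariance S) with hR
  have hRR : R * R = realCovariance S := by
    exact CFC.sqrt_mul_sqrt_self _ hC.nonneg
  have hRsymm (i j) : R i j = R j i := by
    have h : R.IsHermitian := by
        exact (CFC.sqrt_nonneg (realCovariance S)).isSelfAdjoint
    simpa using h.apply j i
  have hsum (i j) : ∑ k, (R i k : ℂ) * (R j k : ℂ) = (realCovariance S i j : ℝ) := by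
    rw [← hRR, Matrix.mul_apply]
    push_cast
    exact Finset.sum_congr rfl fun k _ => by rw [hRsymm j k]
  refine ⟨fun i k => (R (Sum.inl i) k : ℂ) + Complex.I * (R (Sum.inr i) k : ℂ),
    fun i j => ?_, fun i j => ?_, fun m => ?_⟩
  · calc _ = (∑ k, (R (Sum.inl i) k : ℂ) * (R (Sum.inl j) k : ℂ)) -
          (∑ k, (R (Sum.inr i) k : ℂ) * (R (Sum.inr j) k : ℂ)) +
          Complex.I * (∑ k, (R (Sum.inl i) k : ℂ) * (R (Sum.inr j) k : ℂ)) +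
          Complex.I * (∑ k, (R (Sum.inr i) k : ℂ) * (R (Sum.inl j) k : ℂ)) := by
          rw [Finset.mul_sum, Finset.mul_sum, ← Finset.sum_sub_distrib, ← Finset.sum_add_distrib,
            ← Finset.sum_add_distrib]
          refine Finset.sum_congr rfl fun k _ => ?_
          linear_combination ((R (Sum.inr i) k : ℂ) * (R (Sum.inr j) k : ℂ)) * Complex.I_sq
      _ = 0 := by
          simp only [hsum]
          simp [realCovariance]
  · calc _ = (∑ k, (R (Sum.inl i) k : ℂ) * (R (Sum.inl j) k : ℂ)) +
          (∑ k, (R (Sum.inr i) k : ℂ) * (R (Sum.inr j) k : ℂ)) -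
          Complex.I * (∑ k, (R (Sum.inl i) k : ℂ) * (R (Sum.inr j) k : ℂ)) +
          Complex.I * (∑ k, (R (Sum.inr i) k : ℂ) * (R (Sum.inl j) k : ℂ)) := by
          rw [Finset.mul_sum, Finset.mul_sum, ← Finset.sum_add_distrib, ← Finset.sum_sub_distrib,
            ← Finset.sum_add_distrib]
          refine Finset.sum_congr rfl fun k _ => ?_
          simp only [map_add, map_mul, Complex.conj_I, Complex.conj_ofReal]
          linear_combination (-(R (Sum.inr i) k : ℂ) * (R (Sum.inr j) k : ℂ)) * Complex.I_sq
      _ = S i j := by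
          simp only [hsum]
          simp only [realCovariance, Matrix.fromBlocks_apply₁₁, Matrix.fromBlocks_apply₁₂,
            Matrix.fromBlocks_apply₂₁, Matrix.fromBlocks_apply₂₂, Matrix.map_apply,
            Matrix.neg_apply]
          push_cast
          linear_combination Complex.re_add_im (S i j)
  · rw [complexNormal, multivariateGaussian, ← map_pi_eq_stdGaussian,
      Measure.map_map (by fun_prop) (by fun_prop), Measure.map_map (by fun_prop) (by fun_prop)]
    congr 1
    ext ξ i
    simp only [Function.comp_apply, PiLp.add_apply, Matrix.toEuclideanCLM_toLp, realMean,
      Sum.elim_inl, Sum.elim_inr, Matrix.mulVec, dotProduct, ← hR]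
    push_cast
    conv_rhs => rw [← Complex.re_add_im (m i)]
    simp only [add_mul, Finset.sum_add_distrib, mul_add, Finset.mul_sum, mul_assoc]
    ring

lemma measurable_gramSum {p ν : ℕ} : Measurable (gramSum : (Fin ν → Fin p → ℂ) → _) := by
  refine measurable_pi_iff.2 fun i => measurable_pi_iff.2 fun j => ?_
  simp only [gramSum, Matrix.of_apply]
  fun_prop

lemma measurable_matrix_entry {p : ℕ} (i j : Fin p) :
    Measurable fun W : Matrix (Fin p) (Fin p) ℂ => W i j :=
  (measurable_pi_apply j).comp (measurable_pi_apply (X := fun _ => Fin p → ℂ) i)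

/-- The coefficients `l` placed in row `t` of an array whose other rows are zero. -/
def rowLift {τ κ : Type*} [DecidableEq τ] (l : κ → ℂ) (t : τ) : τ × κ → ℂ :=
  fun s => if s.1 = t then l s.2 else 0

lemma sum_rowLift_mul {τ κ : Type*} [Fintype τ] [Fintype κ] [DecidableEq τ] (l l' : κ → ℂ)
    (t t' : τ) :
    ∑ s, rowLift l t s * rowLift l' t' s = if t = t' then ∑ k, l k * l' k else 0 := by
  simp only [rowLift, Fintype.sum_prod_type]
  split_ifs with h
  · subst h
    simp [ite_mul, Finset.sum_ite_irrel]
  · refine Finset.sum_eq_zero fun s _ => Finset.sum_eq_zero fun k _ => ?_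
    by_cases hs : s = t
    · simp [hs, h]
    · simp [hs]

open Classical in
/-- Product moments of the Wishart matrix before the row labels `f` are summed out. -/
theorem integral_prod_gramSum {n p ν : ℕ} {S : Matrix (Fin p) (Fin p) ℂ} (hS : S.PosSemidef)
    (m : Fin ν → Fin p → ℂ) (a b : Fin n → Fin p) :
    Integrable (fun W : Matrix (Fin p) (Fin p) ℂ => ∏ i, W (a i) (b i))
      ((Measure.pi fun t => complexNormal (m t) S).map gramSum) ∧
    ∫ W : Matrix (Fin p) (Fin p) ℂ, ∏ i, W (a i) (b i)
        ∂(Measure.pi fun t => complexNormal (m t) S).map gramSum =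
      ∑ f : Fin n → Fin ν, ∑ g : Fin n → Option (Fin n),
        if IsPartialInjection Finset.univ g then
          (∏ i, (g i).elim (m (f i) (a i)) fun j => if f i = f j then S (a i) (b j) else 0) *
            ∏ j with ∀ i, g i ≠ some j, (starRingEnd ℂ) (m (f j) (b j)) else 0 := by
  obtain ⟨L, hL0, hLS, hL⟩ := exists_complexNormal_eq_map hS
  have hlaw : (Measure.pi fun t => complexNormal (m t) S) =
      (gaussianArray (Fin ν) (Fin p ⊕ Fin p)).map
        fun ξ t i => m t i + ∑ k, L i k * (ξ t k : ℂ) := by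
    simp only [hL]
    have hpr (t : Fin ν) : IsProbabilityMeasure
        ((Measure.pi fun _ : Fin p ⊕ Fin p => gaussianReal 0 1).map
          fun ξ i => m t i + ∑ k, L i k * (ξ k : ℂ)) :=
      Measure.isProbabilityMeasure_map (Measurable.aemeasurable (by fun_prop))
    exact (Measure.pi_map_pi (f := fun t (ξ : Fin p ⊕ Fin p → ℝ) i =>
      m t i + ∑ k, L i k * (ξ k : ℂ)) fun t => Measurable.aemeasurable (by fun_prop)).symm
  rw [hlaw, Measure.map_map measurable_gramSum (by fun_prop)]
  have hΦ : Measurable (gramSum ∘ fun (ξ : Fin ν → Fin p ⊕ Fin p → ℝ) t i =>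
      m t i + ∑ k, L i k * (ξ t k : ℂ)) := measurable_gramSum.comp (by fun_prop)
  have hprod : Measurable fun W : Matrix (Fin p) (Fin p) ℂ => ∏ i, W (a i) (b i) :=
    Finset.measurable_prod _ fun i _ => measurable_matrix_entry _ _
  let F : MvPolynomial (Fin ν × (Fin p ⊕ Fin p)) ℂ := ∑ f : Fin n → Fin ν,
    (∏ i, affineForm (m (f i) (a i)) (rowLift (L (a i)) (f i))) *
      ∏ j, affineForm ((starRingEnd ℂ) (m (f j) (b j)))
        (rowLift (fun k => (starRingEnd ℂ) (L (b j) k)) (f j))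
  have hF (ξ : Fin ν → Fin p ⊕ Fin p → ℝ) :
      ∏ i, gramSum (fun t i => m t i + ∑ k, L i k * (ξ t k : ℂ)) (a i) (b i) =
        MvPolynomial.eval (fun s => (ξ s.1 s.2 : ℂ)) F := by
    have heval (c : ℂ) (l : Fin p ⊕ Fin p → ℂ) (t : Fin ν) :
        MvPolynomial.eval (fun s => (ξ s.1 s.2 : ℂ)) (affineForm c (rowLift l t)) =
          c + ∑ k, l k * (ξ t k : ℂ) := by
      simp only [affineForm, rowLift, map_add, map_sum, map_mul, MvPolynomial.eval_C,
        MvPolynomial.eval_X, Fintype.sum_prod_type, ite_mul, zero_mul]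
      rw [Finset.sum_eq_single t (fun s _ hs => by simp [hs]) (by simp)]
      simp
    simp only [F, gramSum, Matrix.of_apply, Fintype.prod_sum, map_sum, map_mul, map_prod, heval,
      ← Finset.prod_mul_distrib]
    simp
  constructor
  · rw [integrable_map_measure hprod.aestronglyMeasurable hΦ.aemeasurable]
    exact (integrable_eval_gaussianArray F).congr (Filter.Eventually.of_forall fun ξ => (hF ξ).symm)
  · rw [integral_map hΦ.aemeasurable hprod.aestronglyMeasurable]
    simp only [Function.comp_apply, hF]
    change gaussianExpectation _ _ F = _
    simp only [F, map_sum]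
    refine Finset.sum_congr rfl fun f _ => ?_
    have hconj (j j' : Fin n) : ∑ s, rowLift (fun k => (starRingEnd ℂ) (L (b j) k)) (f j) s *
        rowLift (fun k => (starRingEnd ℂ) (L (b j') k)) (f j') s = 0 := by
      refine (sum_rowLift_mul _ _ _ _).trans ?_
      simp only [← map_mul, ← map_sum, hL0]
      simp
    have hplain (i i' : Fin n) : ∑ s, rowLift (L (a i)) (f i) s * rowLift (L (a i')) (f i') s = 0 := by
      rw [sum_rowLift_mul]
      simp [hL0]
    have hmixed (i j : Fin n) : ∑ s, rowLift (L (a i)) (f i) s *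
        rowLift (fun k => (starRingEnd ℂ) (L (b j) k)) (f j) s =
          if f i = f j then S (a i) (b j) else 0 := by
      exact (sum_rowLift_mul _ _ _ _).trans (by rw [hLS])
    convert expectation_prod_mul_prod (gaussianExpectation (Fin ν) (Fin p ⊕ Fin p))
      gaussianExpectation_one gaussianExpectation_X_mul
      (fun j => (starRingEnd ℂ) (m (f j) (b j))) _ hconj n (fun i => m (f i) (a i)) _ hplain
      (fun i j => if f i = f j then S (a i) (b j) else 0) hmixed Finset.univ

/-! ### Cycles and chains of a graph with in- and out-degrees at most one -/

/-- If `r` is the graph of a partial function, then every vertex weakly connected to a vertex `e`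
without successor reaches `e` by a directed path. -/
lemma reflTransGen_of_terminal {V : Type*} {r : V → V → Prop}
    (hr : ∀ u v v', r u v → r u v' → v = v') {e u : V} (he : ∀ w, ¬ r e w)
    (h : Relation.ReflTransGen (fun a b => r a b ∨ r b a) e u) : Relation.ReflTransGen r u e := by
  induction h with
  | refl => exact .refl
  | tail _ hvu ih =>
    rcases hvu with hvu | huv
    · rcases ih.cases_head with rfl | ⟨w, hvw, hw⟩
      · exact absurd hvu (he _)
      · exact hr _ _ _ hvw hvu ▸ hw
    · exact .head huv ih

lemma terminal_unique {V : Type*} {r : V → V → Prop}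
    (hr : ∀ u v v', r u v → r u v' → v = v') {e e' : V} (he : ∀ w, ¬ r e w) (he' : ∀ w, ¬ r e' w)
    (h : Relation.ReflTransGen (fun a b => r a b ∨ r b a) e e') : e' = e := by
  rcases (reflTransGen_of_terminal hr he h).cases_head with h | ⟨w, hw, -⟩
  · exact h
  · exact absurd hw (he' w)

section Digraph

variable {V : Type*} {G : Digraph V}

lemma diComponentOf_eq_of_adj {u v : V} (h : G.Adj u v) :
    diComponentOf G u = diComponentOf G v := by
  by_cases huv : u = v
  · rw [huv]
  · exact SimpleGraph.ConnectedComponent.sound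
      (SimpleGraph.Adj.reachable (G := G.toSimpleGraphInclusive) ⟨huv, Or.inl h⟩)

lemma reflTransGen_of_diComponentOf_eq {u v : V} (h : diComponentOf G u = diComponentOf G v) :
    Relation.ReflTransGen (fun a b => G.Adj a b ∨ G.Adj b a) u v := by
  have h := SimpleGraph.ConnectedComponent.exact h
  rw [SimpleGraph.reachable_iff_reflTransGen] at h
  exact Relation.ReflTransGen.mono (fun a b hab => hab.2) _ _ h

lemma IsEndTerminal.unique (hG : ∀ u v v', G.Adj u v → G.Adj u v' → v = v') {e e' : V}
    (he : IsEndTerminal G e) (he' : IsEndTerminal G e')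
    (h : diComponentOf G e = diComponentOf G e') : e' = e :=
  terminal_unique hG he he' (reflTransGen_of_diComponentOf_eq h)

lemma IsStartTerminal.unique (hG : ∀ u u' v, G.Adj u v → G.Adj u' v → u = u') {e e' : V}
    (he : IsStartTerminal G e) (he' : IsStartTerminal G e')
    (h : diComponentOf G e = diComponentOf G e') : e' = e :=
  terminal_unique (r := fun a b => G.Adj b a) (fun _ _ _ h h' => hG _ _ _ h h') he he'
    (Relation.ReflTransGen.mono (fun _ _ => Or.symm) _ _ (reflTransGen_of_diComponentOf_eq h))

variable [Fintype V]

open Classical in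
/-- Both the non-ending and the non-starting vertices of a component are in bijection with its
edges. -/
lemma card_endTerminals_eq_card_startTerminals (hG : ∀ u v v', G.Adj u v → G.Adj u v' → v = v')
    (hG' : ∀ u u' v, G.Adj u v → G.Adj u' v → u = u') (c : DiComponent G) :
    (Finset.univ.filter fun v => diComponentOf G v = c ∧ IsEndTerminal G v).card =
      (Finset.univ.filter fun v => diComponentOf G v = c ∧ IsStartTerminal G v).card := by
  have h1 : ((edgePairs G).filter fun e => diComponentOf G e.1 = c).card =
      (Finset.univ.filter fun v => diComponentOf G v = c ∧ ¬ IsEndTerminal G v).card := by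
    refine Finset.card_bij (fun e _ => e.1) ?_ ?_ ?_
    · intro e he
      simp only [edgePairs, Finset.mem_filter, Finset.mem_univ, true_and] at he ⊢
      exact ⟨he.2, fun h => h _ he.1⟩
    · rintro ⟨u, v⟩ he ⟨u', v'⟩ he' rfl
      simp only [edgePairs, Finset.mem_filter, Finset.mem_univ, true_and] at he he'
      rw [hG _ _ _ he.1 he'.1]
    · intro v hv
      simp only [Finset.mem_filter, Finset.mem_univ, true_and, IsEndTerminal, not_forall,
        not_not] at hv
      obtain ⟨hv, w, hw⟩ := hv
      exact ⟨(v, w), by simp [edgePairs, hw, hv], rfl⟩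
  have h2 : ((edgePairs G).filter fun e => diComponentOf G e.1 = c).card =
      (Finset.univ.filter fun v => diComponentOf G v = c ∧ ¬ IsStartTerminal G v).card := by
    refine Finset.card_bij (fun e _ => e.2) ?_ ?_ ?_
    · intro e he
      simp only [edgePairs, Finset.mem_filter, Finset.mem_univ, true_and] at he ⊢
      exact ⟨(diComponentOf_eq_of_adj he.1).symm.trans he.2, fun h => h _ he.1⟩
    · rintro ⟨u, v⟩ he ⟨u', v'⟩ he' rfl
      simp only [edgePairs, Finset.mem_filter, Finset.mem_univ, true_and] at he he'
      rw [hG' _ _ _ he.1 he'.1]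
    · intro v hv
      simp only [Finset.mem_filter, Finset.mem_univ, true_and, IsStartTerminal, not_forall,
        not_not] at hv
      obtain ⟨hv, w, hw⟩ := hv
      exact ⟨(w, v), Finset.mem_filter.2
        ⟨by simp [edgePairs, hw], (diComponentOf_eq_of_adj hw).trans hv⟩, rfl⟩
  have h3 := Finset.card_filter_add_card_filter_not
    (s := Finset.univ.filter fun v => diComponentOf G v = c) (IsEndTerminal G)
  have h4 := Finset.card_filter_add_card_filter_not
    (s := Finset.univ.filter fun v => diComponentOf G v = c) (IsStartTerminal G)
  simp only [Finset.filter_filter] at h3 h4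
  omega

/-- A component that is not a cycle is a chain: it has both kinds of terminals. -/
lemma exists_mem_chainPairs (hG : ∀ u v v', G.Adj u v → G.Adj u v' → v = v')
    (hG' : ∀ u u' v, G.Adj u v → G.Adj u' v → u = u') {c : DiComponent G}
    (hc : ¬ IsCycleComponent G c) : ∃ e ∈ chainPairs G, diComponentOf G e.1 = c := by
  classical
  have hcard := card_endTerminals_eq_card_startTerminals hG hG' c
  obtain ⟨v, hv, h⟩ : ∃ v, diComponentOf G v = c ∧ (IsStartTerminal G v ∨ IsEndTerminal G v) := by
    simp only [IsCycleComponent, not_forall] at hc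
    obtain ⟨v, hv, h⟩ := hc
    exact ⟨v, hv, by tauto⟩
  have hpos : 0 < (Finset.univ.filter fun v => diComponentOf G v = c ∧ IsEndTerminal G v).card := by
    rcases h with h | h
    · rw [hcard]
      exact Finset.card_pos.2 ⟨v, by simp [hv, h]⟩
    · exact Finset.card_pos.2 ⟨v, by simp [hv, h]⟩
  obtain ⟨e, he⟩ := Finset.card_pos.1 hpos
  obtain ⟨s, hs⟩ := Finset.card_pos.1 (hcard ▸ hpos)
  simp only [Finset.mem_filter, Finset.mem_univ, true_and] at he hs
  exact ⟨(e, s), Finset.mem_filter.2 ⟨Finset.mem_univ _, he.2, hs.2, he.1.trans hs.1.symm⟩, he.1⟩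

open Classical in
/-- Summing over the vertex labellings that are constant along edges, that is, constant on
components: every cycle contributes a factor `card T`, every chain the sum over its label. -/
theorem sum_prod_terminals {T : Type*} [Fintype T]
    (hG : ∀ u v v', G.Adj u v → G.Adj u v' → v = v')
    (hG' : ∀ u u' v, G.Adj u v → G.Adj u' v → u = u') (x y : T → V → ℂ) :
    (∑ f : V → T with ∀ e ∈ edgePairs G, f e.1 = f e.2,
      (∏ i with IsEndTerminal G i, x (f i) i) * ∏ j with IsStartTerminal G j, y (f j) j) =
      (Fintype.card T : ℂ) ^ numCycles G * ∏ e ∈ chainPairs G, ∑ t, x t e.1 * y t e.2 := by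
  -- The contribution of the component `c` when its vertices carry the label `t`.
  let h (c : DiComponent G) (t : T) : ℂ :=
    (∏ i with IsEndTerminal G i ∧ diComponentOf G i = c, x t i) *
      ∏ j with IsStartTerminal G j ∧ diComponentOf G j = c, y t j
  have hterm (F : DiComponent G → T) :
      (∏ i with IsEndTerminal G i, x (F (diComponentOf G i)) i) *
        (∏ j with IsStartTerminal G j, y (F (diComponentOf G j)) j) = ∏ c, h c (F c) := by
    simp only [h, Finset.prod_mul_distrib]
    congr 1 <;>
    · rw [← Finset.prod_fiberwise _ (diComponentOf G)]
      refine Finset.prod_congr rfl fun c _ => ?_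
      rw [Finset.filter_filter]
      refine Finset.prod_congr rfl fun i hi => ?_
      rw [(Finset.mem_filter.1 hi).2.2]
  have hlabel : (∑ f : V → T with ∀ e ∈ edgePairs G, f e.1 = f e.2,
      (∏ i with IsEndTerminal G i, x (f i) i) * ∏ j with IsStartTerminal G j, y (f j) j) =
      ∑ F : DiComponent G → T, ∏ c, h c (F c) := by
    symm
    refine Finset.sum_bij (fun F _ v => F (diComponentOf G v)) ?_ ?_ ?_ ?_
    · intro F _
      simp only [Finset.mem_filter, Finset.mem_univ, true_and, edgePairs]
      intro e he
      rw [diComponentOf_eq_of_adj he]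
    · intro F _ F' _ hFF
      funext c
      induction c using SimpleGraph.ConnectedComponent.ind with
      | _ v => exact congrFun hFF v
    · intro f hf
      simp only [Finset.mem_filter, Finset.mem_univ, true_and, edgePairs] at hf
      have hconst (u v : V) (huv : diComponentOf G u = diComponentOf G v) : f u = f v := by
        have hr := reflTransGen_of_diComponentOf_eq huv
        clear huv
        induction hr with
        | refl => rfl
        | tail _ h2 ih =>
          rw [ih]
          exact h2.elim (fun h => hf (_, _) h) fun h => (hf (_, _) h).symm
      exact ⟨fun c => f c.out, Finset.mem_univ _, funext fun v => hconst _ _ (Quot.out_eq _)⟩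
    · intro F _
      exact (hterm F).symm
  rw [hlabel, ← Fintype.prod_sum, ← Finset.prod_filter_mul_prod_filter_not _ (IsCycleComponent G)]
  congr 1
  · have h1 : ∀ c ∈ Finset.univ.filter (IsCycleComponent G), ∑ t, h c t = Fintype.card T := by
      intro c hc
      have hc := (Finset.mem_filter.1 hc).2
      have h1 : (Finset.univ.filter fun i => IsEndTerminal G i ∧ diComponentOf G i = c) = ∅ :=
        Finset.filter_eq_empty_iff.2 fun i _ hi => (hc i hi.2).2 hi.1
      have h2 : (Finset.univ.filter fun i => IsStartTerminal G i ∧ diComponentOf G i = c) = ∅ :=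
        Finset.filter_eq_empty_iff.2 fun i _ hi => (hc i hi.2).1 hi.1
      simp [h, h1, h2]
    rw [Finset.prod_congr rfl h1, Finset.prod_const, numCycles, Nat.card_eq_fintype_card,
      Fintype.card_subtype]
  · symm
    refine Finset.prod_bij (fun e _ => diComponentOf G e.1) ?_ ?_ ?_ ?_
    · intro e he
      simp only [chainPairs, Finset.mem_filter, Finset.mem_univ, true_and] at he ⊢
      exact fun hc => (hc _ rfl).2 he.1
    · intro e he e' he' hee
      simp only [chainPairs, Finset.mem_filter, Finset.mem_univ, true_and] at he he'
      refine Prod.ext (he'.1.unique hG he.1 hee.symm) (he'.2.1.unique hG' he.2.1 ?_)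
      rw [← he.2.2, ← he'.2.2, hee]
    · intro c hc
      obtain ⟨e, he, hec⟩ := exists_mem_chainPairs hG hG' (Finset.mem_filter.1 hc).2
      exact ⟨e, he, hec⟩
    · intro e he
      simp only [chainPairs, Finset.mem_filter, Finset.mem_univ, true_and] at he
      have h1 : (Finset.univ.filter fun i => IsEndTerminal G i ∧
          diComponentOf G i = diComponentOf G e.1) = {e.1} := by
        ext i
        simp only [Finset.mem_filter, Finset.mem_univ, true_and, Finset.mem_singleton]
        exact ⟨fun hi => he.1.unique hG hi.1 hi.2.symm, by rintro rfl; exact ⟨he.1, rfl⟩⟩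
      have h2 : (Finset.univ.filter fun i => IsStartTerminal G i ∧
          diComponentOf G i = diComponentOf G e.1) = {e.2} := by
        ext i
        simp only [Finset.mem_filter, Finset.mem_univ, true_and, Finset.mem_singleton]
        exact ⟨fun hi => he.2.1.unique hG' hi.1 (he.2.2.symm.trans hi.2.symm),
          by rintro rfl; exact ⟨he.2.1, he.2.2.symm⟩⟩
      simp only [h, h1, h2, Finset.prod_singleton]

end Digraph

/-! ### From partial injections to graphs -/

section InjectionGraph

variable {n : ℕ} (V₁ : Finset (Fin n)) (π : V₁ ↪ Fin n)

/-- The injection `π : V₁ → Fin n` as an `Option`-valued function, equal to `none` off `V₁`. -/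
def toOption (i : Fin n) : Option (Fin n) := if h : i ∈ V₁ then some (π ⟨i, h⟩) else none

lemma toOption_eq_some_iff (i j : Fin n) :
    toOption V₁ π i = some j ↔ (injectionGraph V₁ π).Adj i j := by
  by_cases h : i ∈ V₁ <;> simp [toOption, injectionGraph, h]

lemma injectionGraph_adj_right_unique (u v v' : Fin n) (h : (injectionGraph V₁ π).Adj u v)
    (h' : (injectionGraph V₁ π).Adj u v') : v = v' := by
  obtain ⟨h, rfl⟩ := h
  obtain ⟨h', rfl⟩ := h'
  rfl

lemma injectionGraph_adj_left_unique (u u' v : Fin n) (h : (injectionGraph V₁ π).Adj u v)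
    (h' : (injectionGraph V₁ π).Adj u' v) : u = u' := by
  obtain ⟨h, rfl⟩ := h
  obtain ⟨h', he⟩ := h'
  exact (congrArg Subtype.val (π.injective he)).symm

lemma isPartialInjection_toOption : IsPartialInjection Finset.univ (toOption V₁ π) := by
  refine ⟨fun _ _ _ => Finset.mem_univ _, fun i j b hi hj => ?_⟩
  rw [toOption_eq_some_iff] at hi hj
  exact injectionGraph_adj_left_unique V₁ π i j b hi hj

open Classical in
lemma sum_isPartialInjection_eq_sum_embedding (F : (Fin n → Option (Fin n)) → ℂ) :
    (∑ g : Fin n → Option (Fin n), if IsPartialInjection Finset.univ g then F g else 0) =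
      ∑ V₁ : Finset (Fin n), ∑ π : V₁ ↪ Fin n, F (toOption V₁ π) := by
  rw [← Finset.sum_filter, ← Fintype.sum_sigma']
  symm
  refine Finset.sum_bij (fun q _ => toOption q.1 q.2) ?_ ?_ ?_ fun _ _ => rfl
  · exact fun q _ => Finset.mem_filter.2 ⟨Finset.mem_univ _, isPartialInjection_toOption _ _⟩
  · rintro ⟨V₁, π⟩ - ⟨V₁', π'⟩ - h
    have hV : V₁ = V₁' := by
      ext i
      have hi := congrArg Option.isSome (congrFun h i)
      by_cases h1 : i ∈ V₁ <;> by_cases h2 : i ∈ V₁' <;> simp_all [toOption]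
    subst hV
    congr 1
    ext i
    have hi := congrFun h i
    simp only [toOption, i.2, dite_true, Option.some.injEq] at hi
    exact congrArg Fin.val hi
  · intro g hg
    have hg := (Finset.mem_filter.1 hg).2
    refine ⟨⟨Finset.univ.filter fun i => (g i).isSome,
      ⟨fun i => (g i).get (Finset.mem_filter.1 i.2).2, fun i j hij => ?_⟩⟩, Finset.mem_univ _, ?_⟩
    · exact Subtype.ext (hg.2 i j _ (Option.some_get _).symm
        ((Option.some_get _).symm.trans (congrArg some hij.symm)))
    · funext i
      by_cases h : (g i).isSome
      · simp only [toOption, Finset.mem_filter, Finset.mem_univ, true_and, h, dite_true]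
        exact Option.some_get h
      · simp [toOption, Option.not_isSome_iff_eq_none.1 h]

open Classical in
/-- The Wick weight of an injection, for row labels `f`, in terms of its graph: the labels have to
agree along edges, and the means are taken at the terminals. -/
lemma wick_weight_eq {T : Type*} (f : Fin n → T) (x y : T → Fin n → ℂ) (s : Fin n → Fin n → ℂ) :
    (∏ i, (toOption V₁ π i).elim (x (f i) i) fun j => if f i = f j then s i j else 0) *
        ∏ j with ∀ i, toOption V₁ π i ≠ some j, y (f j) j =
      if ∀ e ∈ edgePairs (injectionGraph V₁ π), f e.1 = f e.2 then
        (∏ e ∈ edgePairs (injectionGraph V₁ π), s e.1 e.2) *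
          ((∏ i with IsEndTerminal (injectionGraph V₁ π) i, x (f i) i) *
            ∏ j with IsStartTerminal (injectionGraph V₁ π) j, y (f j) j) else 0 := by
  set G := injectionGraph V₁ π with hG
  have hend (i : Fin n) : IsEndTerminal G i ↔ toOption V₁ π i = none := by
    simp [IsEndTerminal, Option.eq_none_iff_forall_ne_some, toOption_eq_some_iff, hG]
  have hstart : (Finset.univ.filter fun j => ∀ i, toOption V₁ π i ≠ some j) =
      Finset.univ.filter fun j => IsStartTerminal G j := by
    ext j
    simp [IsStartTerminal, toOption_eq_some_iff, hG]
  have hedges : (∏ i with ¬ IsEndTerminal G i,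
      (toOption V₁ π i).elim (x (f i) i) fun j => if f i = f j then s i j else 0) =
      ∏ e ∈ edgePairs G, if f e.1 = f e.2 then s e.1 e.2 else 0 := by
    symm
    refine Finset.prod_bij (fun e _ => e.1) ?_ ?_ ?_ ?_
    · intro e he
      simp only [edgePairs, Finset.mem_filter, Finset.mem_univ, true_and] at he ⊢
      exact fun h => h _ he
    · rintro ⟨u, v⟩ he ⟨u', v'⟩ he' rfl
      simp only [edgePairs, Finset.mem_filter, Finset.mem_univ, true_and] at he he'
      rw [injectionGraph_adj_right_unique V₁ π _ _ _ he he']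
    · intro i hi
      simp only [Finset.mem_filter, Finset.mem_univ, true_and, IsEndTerminal, not_forall,
        not_not] at hi
      obtain ⟨j, hj⟩ := hi
      exact ⟨(i, j), by simp [edgePairs, hj], rfl⟩
    · intro e he
      simp only [edgePairs, Finset.mem_filter, Finset.mem_univ, true_and] at he
      rw [(toOption_eq_some_iff V₁ π e.1 e.2).2 he, Option.elim_some]
  rw [hstart, ← Finset.prod_filter_mul_prod_filter_not _ (IsEndTerminal G), hedges,
    Finset.prod_ite_zero, Finset.prod_congr rfl fun i hi => by
      rw [(hend i).1 (Finset.mem_filter.1 hi).2, Option.elim_none]]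
  split_ifs
  · ring
  · simp

open Classical in
lemma sum_wick_weight {T : Type*} [Fintype T] (x y : T → Fin n → ℂ) (s : Fin n → Fin n → ℂ) :
    ∑ f : Fin n → T, (∏ i, (toOption V₁ π i).elim (x (f i) i)
        fun j => if f i = f j then s i j else 0) *
          ∏ j with ∀ i, toOption V₁ π i ≠ some j, y (f j) j =
      (Fintype.card T : ℂ) ^ numCycles (injectionGraph V₁ π) *
        (∏ e ∈ edgePairs (injectionGraph V₁ π), s e.1 e.2) *
          ∏ e ∈ chainPairs (injectionGraph V₁ π), ∑ t, x t e.1 * y t e.2 := by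
  simp only [wick_weight_eq]
  have key := sum_prod_terminals (injectionGraph_adj_right_unique V₁ π)
    (injectionGraph_adj_left_unique V₁ π) x y
  rw [← Finset.sum_filter, ← Finset.mul_sum, mul_comm ((Fintype.card T : ℂ) ^ _), mul_assoc, ← key]
  congr!

end InjectionGraph

theorem theorem5 {Ω : Type*} [MeasurableSpace Ω] (P : Measure Ω) [IsProbabilityMeasure P]
    (n p ν : ℕ) (hp : n + n ≤ p)
    (S D : Matrix (Fin p) (Fin p) ℂ) (hS : S.PosSemidef)
    (Q : Measure (Matrix (Fin p) (Fin p) ℂ)) (hQ : IsComplexWishart ν S D Q)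
    (W : Ω → Matrix (Fin p) (Fin p) ℂ) (hW : HasLaw W Q P) :
    Integrable (fun ω => ∏ i : Fin n, W ω (plainIdx hp i) (barIdx hp i)) P ∧
    ∫ ω, ∏ i : Fin n, W ω (plainIdx hp i) (barIdx hp i) ∂P =
      ∑ V₁ : Finset (Fin n), ∑ π : V₁ ↪ Fin n,
        (ν : ℂ) ^ numCycles (injectionGraph V₁ π) *
        (∏ e ∈ edgePairs (injectionGraph V₁ π), S (plainIdx hp e.1) (barIdx hp e.2)) *
        (∏ e ∈ chainPairs (injectionGraph V₁ π), D (plainIdx hp e.1) (barIdx hp e.2)) := by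
  classical
  obtain ⟨m, rfl, rfl⟩ := hQ
  obtain ⟨hint, hval⟩ := integral_prod_gramSum hS m (plainIdx hp) (barIdx hp)
  rw [← hW.map_eq] at hint hval
  have hprod : Measurable fun W : Matrix (Fin p) (Fin p) ℂ =>
      ∏ i : Fin n, W (plainIdx hp i) (barIdx hp i) :=
    Finset.measurable_prod _ fun i _ => measurable_matrix_entry _ _
  refine ⟨(integrable_map_measure hprod.aestronglyMeasurable hW.aemeasurable).1 hint, ?_⟩
  rw [integral_map hW.aemeasurable hprod.aestronglyMeasurable] at hval
  rw [hval]
  simp only [sum_isPartialInjection_eq_sum_embedding]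
  rw [Finset.sum_comm]
  refine Finset.sum_congr rfl fun V₁ _ => ?_
  rw [Finset.sum_comm]
  refine Finset.sum_congr rfl fun π _ => ?_
  have h := sum_wick_weight V₁ π (fun t i => m t (plainIdx hp i))
    (fun t j => (starRingEnd ℂ) (m t (barIdx hp j)))
    (fun i j => S (plainIdx hp i) (barIdx hp j))
  rw [Fintype.card_fin] at h
  convert h
  rfl
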